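/- Let $G=(V,E)$ be a finite strongly connected digraph and let $s\in V$ be an arbitrary start vertex. Let $G_s$ denote $G$ viewed as a flow graph with start vertex $s$, and let $G_s^R$ denote the reverse digraph of $G$ viewed as a flow graph with start vertex $s$. For $G_s$, a vertex $u$ \emph{dominates} $v$ if every path from $s$ to $v$ contains $u$. The \emph{dominator tree} $D$ is the tree rooted at $s$ in which $u$ is an ancestor of $v$ if and only if $u$ dominates $v$. An edge $(u,v)\in E$ is a \emph{bridge} of $G_s$ if every path from $s$ to $v$ contains $(u,v)$; then $u$ is the parent of $v$ in $D$. Deleting all bridges from $D$ yields a forest, the \emph{bridge decomposition}; let $r_x$ denote the root of the tree of this forest that contains $x$. For each such root $r$ let $V_r=\{v\in V: r_v=r\}$. The \emph{auxiliary graph} $\widehat G_r$ has vertex set $V_r$ and is obtained from the subgraph of $G$ induced by the descendants of $r$ in $D$ by contracting, for every $v\in V_r$ and every child $w\notin V_r$ of $v$ in $D$, the vertex $w$ and all its descendants in $D$ into $v$. The \emph{auxiliary components} of $G_s$ are the (vertex sets of the) strongly connected components of the graphs $\widehat G_r$. In each auxiliary component choose an arbitrary \emph{canonical vertex}, and let $c_x$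 be the canonical vertex of the auxiliary component that contains $x$. Define $r^R_x$ and $c^R_x$ in the same way for $G_s^R$ (with its own arbitrary choice of canonical vertices), and let $$\mathit{label}(x)=\langle r_x,\,c_x,\,r^R_x,\,c^R_x\rangle .$$ Two vertices $x,y$ are \emph{2-edge-connected} if there are two edge-disjoint directed paths from $x$ to $y$ and two edge-disjoint directed paths from $y$ to $x$ (every vertex is 2-edge-connected to itself, by trivial paths). Then, for all $x,y\in V$, the vertices $x$ and $y$ are 2-edge-connected if and only if $\mathit{label}(x)=\mathit{label}(y)$. -/

import Mathlib

namespace Digraph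

variable {V : Type*}

/-- Directed walks (paths in which vertices and edges may repeat) of a digraph. -/
inductive Walk (G : Digraph V) : V → V → Type _
  | nil (u : V) : Walk G u u
  | cons {u v w : V} (h : G.Adj u v) (p : Walk G v w) : Walk G u w

namespace Walk

variable {G : Digraph V}

/-- The list of vertices of a walk, endpoints included. -/
def support : {u v : V} → G.Walk u v → List V
  | _, _, nil u => [u]
  | u, _, cons _ p => u :: p.support

/-- The list of edges of a walk, as ordered pairs (tail, head). -/
def edges : {u v : V} → G.Walk u v → List (V × V)
  | _, _, nil _ => []
  | _, _, @cons _ _ u v _ _ p => (u, v) :: p.edges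

end Walk

/-- `v` is reachable from `u`. -/
def Reaches (G : Digraph V) (u v : V) : Prop := Nonempty (G.Walk u v)

/-- There is a directed path from each vertex to every other vertex. -/
def StronglyConnected (G : Digraph V) : Prop := ∀ u v, G.Reaches u v

/-- The vertex set of the strongly connected component containing `x`. -/
def scc (G : Digraph V) (x : V) : Set V := {y | G.Reaches x y ∧ G.Reaches y x}

/-- The reverse digraph. -/
def reverse (G : Digraph V) : Digraph V where
  Adj u v := G.Adj v u

/-- There are two edge-disjoint directed paths from `u` to `v`. -/
def TwoEdgeDisjointPaths (G : Digraph V) (u v : V) : Prop :=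
  ∃ p q : G.Walk u v, p.edges.Disjoint q.edges

/-- Two vertices are 2-edge-connected: two edge-disjoint directed paths in each direction. -/
def TwoEdgeConnected (G : Digraph V) (u v : V) : Prop :=
  G.TwoEdgeDisjointPaths u v ∧ G.TwoEdgeDisjointPaths v u

/-- `u` dominates `v` in the flow graph `G` with start vertex `s`. By definition of the dominator
tree `D`, this says that `u` is an ancestor of `v` (and `v` a descendant of `u`) in `D`. -/
def Dominates (G : Digraph V) (s u v : V) : Prop := ∀ p : G.Walk s v, u ∈ p.support

/-- The dominator tree `D` of the flow graph `G` with start vertex `s`, with its edges directed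
away from the root: the parent `d(v)` of `v` is the proper dominator of `v` that is dominated by
all proper dominators of `v`. -/
def domTree (G : Digraph V) (s : V) : Digraph V where
  Adj u v := u ≠ v ∧ G.Dominates s u v ∧ ∀ w, w ≠ v → G.Dominates s w v → G.Dominates s w u

/-- The edge `(u, v)` is a bridge of the flow graph `G` with start vertex `s`. -/
def IsBridge (G : Digraph V) (s u v : V) : Prop :=
  G.Adj u v ∧ ∀ p : G.Walk s v, (u, v) ∈ p.edges

/-- The bridge decomposition: the forest obtained from the dominator tree by deleting the
bridges of the flow graph. -/
def bridgeForest (G : Digraph V) (s : V) : Digraph V where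
  Adj u v := (G.domTree s).Adj u v ∧ ¬ G.IsBridge s u v

/-- `r` is the root of the tree of the bridge decomposition that contains `u`: it is an ancestor
of `u` in the forest and has no parent in the forest. -/
def IsBridgeRoot (G : Digraph V) (s r u : V) : Prop :=
  (G.bridgeForest s).Reaches r u ∧ ∀ w, ¬ (G.bridgeForest s).Adj w r

open Classical in
/-- The root `r_u` of the tree of the bridge decomposition containing `u`. (It exists and is
unique in every finite flow graph, see `existsUnique_isBridgeRoot` below.) -/
noncomputable def bridgeRoot (G : Digraph V) (s u : V) : V :=
  if h : ∃ r, G.IsBridgeRoot s r u then h.choose else u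

/-- The vertex set `V_r` of the auxiliary graph of `r`: the vertices of the tree with root `r`
of the bridge decomposition. -/
def auxVertices (G : Digraph V) (s r : V) : Set V := {v | G.bridgeRoot s v = r}

/-- The vertex `v` of `G` becomes the vertex `a` of `V_r` in the contraction that defines the
auxiliary graph of `r`: either `v = a`, or `v` is a descendant in `D` of a child `w` of `a` in `D`
that lies outside `V_r`. (Vertices that are not descendants of `r` become no vertex of `V_r`.) -/
def ContractsTo (G : Digraph V) (s r v a : V) : Prop :=
  a ∈ G.auxVertices s r ∧
    (v = a ∨ ∃ w, (G.domTree s).Adj a w ∧ w ∉ G.auxVertices s r ∧ G.Dominates s w v)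

/-- The auxiliary graph of `r`: its vertices are those of the tree with root `r` of the bridge
decomposition, its edges are the edges of `G` among them and the edges obtained
by the contraction. (A contracted edge may be a loop, which does not affect the SCCs.) -/
def auxGraph (G : Digraph V) (s r : V) : Digraph (G.auxVertices s r) where
  Adj a b := ∃ u v, G.Adj u v ∧ G.ContractsTo s r u a ∧ G.ContractsTo s r v b

/-- The auxiliary component containing `x`: the SCC of `x` in the auxiliary graph of `r_x`,
as a set of vertices of `G`. -/
def auxComponent (G : Digraph V) (s x : V) : Set V :=
  Subtype.val '' (G.auxGraph s (G.bridgeRoot s x)).scc ⟨x, rfl⟩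

/-- `can` picks a (canonical) vertex in each auxiliary component. Its values on other sets are
irrelevant. -/
def IsCanonicalChoice (G : Digraph V) (s : V) (can : Set V → V) : Prop :=
  ∀ x, can (G.auxComponent s x) ∈ G.auxComponent s x

/-- The label `⟨r_x, c_x, r^R_x, c^R_x⟩` of `x`, for the start vertex `s` and the choices `can`,
`canR` of canonical vertices of the auxiliary components of `G_s` and of `G_s^R`. -/
noncomputable def label (G : Digraph V) (s : V) (can canR : Set V → V) (x : V) : V × V × V × V :=
  (G.bridgeRoot s x, can (G.auxComponent s x),
    G.reverse.bridgeRoot s x, canR (G.reverse.auxComponent s x))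

/-! The remaining facts show that the roots of the bridge decomposition are well defined. -/

theorem Walk.exists_prefix {G : Digraph V} {u v w : V} (p : G.Walk u v) (h : w ∈ p.support) :
    ∃ q : G.Walk u w, q.support.length ≤ p.support.length ∧ (∀ x ∈ q.support, x ∈ p.support) ∧
      (w ≠ v → q.support.length < p.support.length) := by
  induction p with
  | nil u =>
    simp only [Walk.support, List.mem_singleton] at h
    subst h
    exact ⟨.nil _, le_rfl, fun x hx => hx, fun h => absurd rfl h⟩
  | @cons a b c hab p ih =>
    by_cases hw : w = a
    · subst hw
      refine ⟨.nil _, by simp [Walk.support], by simp [Walk.support], fun _ => ?_⟩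
      cases p <;> simp [Walk.support]
    · obtain ⟨q, h1, h2, h3⟩ := ih (by simpa [Walk.support, hw] using h)
      refine ⟨.cons hab q, by simpa [Walk.support] using h1, ?_, by simpa [Walk.support] using h3⟩
      intro x hx
      simp only [Walk.support, List.mem_cons] at hx ⊢
      exact hx.imp_right (h2 x)

theorem Dominates.trans {G : Digraph V} {s a b c : V} (h1 : G.Dominates s a b)
    (h2 : G.Dominates s b c) : G.Dominates s a c := by
  intro p
  obtain ⟨q, -, hq, -⟩ := p.exists_prefix (h2 p)
  exact hq _ (h1 q)

theorem Dominates.antisymm {G : Digraph V} {s a b : V} (hs : G.Reaches s a)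
    (h1 : G.Dominates s a b) (h2 : G.Dominates s b a) : a = b := by
  by_contra hab
  have key : ∀ n : ℕ, ∀ p : G.Walk s a, p.support.length ≠ n := by
    intro n
    induction n using Nat.strong_induction_on with
    | _ n ih =>
      intro p hp
      obtain ⟨q, -, -, hq⟩ := p.exists_prefix (h2 p)
      obtain ⟨q', hq', -, -⟩ := q.exists_prefix (h1 q)
      exact ih _ (by have := hq (Ne.symm hab); omega) q' rfl
  obtain ⟨p⟩ := hs
  exact key _ p rfl

theorem Walk.exists_last {G : Digraph V} {u v : V} (p : G.Walk u v) :
    u = v ∨ ∃ w, G.Reaches u w ∧ G.Adj w v := by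
  induction p with
  | nil u => exact Or.inl rfl
  | @cons a b c hab p ih =>
    rcases ih with rfl | ⟨w, ⟨q⟩, hw⟩
    · exact Or.inr ⟨a, ⟨.nil a⟩, hab⟩
    · exact Or.inr ⟨w, ⟨.cons hab q⟩, hw⟩

theorem Reaches.concat {G : Digraph V} {u v w : V} (h : G.Reaches u v) (hvw : G.Adj v w) :
    G.Reaches u w := by
  obtain ⟨p⟩ := h
  induction p with
  | nil u => exact ⟨.cons hvw (.nil _)⟩
  | cons hab p ih =>
    obtain ⟨q⟩ := ih hvw
    exact ⟨.cons hab q⟩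

theorem existsUnique_isBridgeRoot [Finite V] (G : Digraph V) (s : V) (hs : ∀ v, G.Reaches s v)
    (u : V) : ∃! r, G.IsBridgeRoot s r u := by
  let R : V → V → Prop := fun a b => a ≠ b ∧ G.Dominates s a b
  have : IsTrans V R := ⟨fun a b c hab hbc => ⟨by
    rintro rfl
    exact hab.1 (hab.2.antisymm (hs _) hbc.2), hab.2.trans hbc.2⟩⟩
  have : Std.Irrefl R := ⟨fun a h => h.1 rfl⟩
  have wf : WellFounded R := Finite.wellFounded_of_trans_of_irrefl R
  have par : ∀ a b c, (G.bridgeForest s).Adj a c → (G.bridgeForest s).Adj b c → a = b := by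
    intro a b c h1 h2
    exact (h2.1.2.2 a h1.1.1 h1.1.2.1).antisymm (hs _) (h1.1.2.2 b h2.1.1 h2.1.2.1)
  induction u using wf.induction with
  | _ u ih =>
    by_cases h : ∃ w, (G.bridgeForest s).Adj w u
    · obtain ⟨w, hw⟩ := h
      obtain ⟨r, hr, hu⟩ := ih w ⟨hw.1.1, hw.1.2.1⟩
      refine ⟨r, ⟨hr.1.concat hw, hr.2⟩, ?_⟩
      rintro r' ⟨⟨p⟩, hr'⟩
      rcases p.exists_last with rfl | ⟨w', h1, h2⟩
      · exact absurd hw (hr' w)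
      · obtain rfl := par _ _ _ h2 hw
        exact hu r' ⟨h1, hr'⟩
    · push Not at h
      refine ⟨u, ⟨⟨.nil u⟩, h⟩, ?_⟩
      rintro r' ⟨⟨p⟩, hr'⟩
      rcases p.exists_last with rfl | ⟨w', h1, h2⟩
      · rfl
      · exact absurd h2 (h w')

end Digraph

/-! By Menger's theorem (`twoEdgeDisjointPaths_iff`), `x` and `y` are 2-edge-connected iff, after
deletion of any single edge, each still reaches the other. The key fact is `IsBridge.dominates_iff`:
the descendants of the head of a bridge are exactly the vertices cut off from `s` by deleting it.

If no deletion separates `x` from `y`, a bridge cuts off both or neither, so their roots dominate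
each other and agree. A walk between them that avoids the bridge into the common root stays below
that root and contracts to a walk in the auxiliary graph (`auxGraph_reaches_of_deleteEdge`). The
same holds in the reverse digraph.

Conversely, let the labels agree and delete `e`. If `s` no longer reaches `x`, then `e` is a bridge
above `r_x`, and the auxiliary walk from `x` to `y` lifts to one avoiding `e`
(`deleteEdge_reaches_of_auxGraph`). If `x` no longer reaches `s`, the reverse digraph gives the
walk. Otherwise `x` reaches `s`, and `s` reaches `y` because equal roots are cut off by the same
edges. -/

namespace Digraph

variable {V : Type*} {G : Digraph V} {s : V}

/-! ### Walks and reachability -/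

theorem Reaches.refl (u : V) : G.Reaches u u := ⟨.nil u⟩

theorem Reaches.of_adj {u v : V} (h : G.Adj u v) : G.Reaches u v := ⟨.cons h (.nil v)⟩

namespace Walk

/-- Concatenation of walks. -/
def append : {u v w : V} → G.Walk u v → G.Walk v w → G.Walk u w
  | _, _, _, nil _, q => q
  | _, _, _, cons h p, q => cons h (p.append q)

theorem start_mem_support {u v : V} (p : G.Walk u v) : u ∈ p.support := by
  cases p <;> simp [support]

theorem end_mem_support {u v : V} (p : G.Walk u v) : v ∈ p.support := by
  induction p with
  | nil u => simp [support]
  | cons h p ih => simp [support, ih]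

theorem mem_support_append {u v w x : V} (p : G.Walk u v) (q : G.Walk v w) :
    x ∈ (p.append q).support ↔ x ∈ p.support ∨ x ∈ q.support := by
  induction p with
  | nil u =>
    simp only [append, support, List.mem_singleton]
    exact ⟨Or.inr, fun h => h.elim (fun h => h ▸ q.start_mem_support) id⟩
  | cons h p ih => simp [append, support, ih, or_assoc]

theorem adj_of_mem_edges {u v : V} (p : G.Walk u v) {e : V × V} (he : e ∈ p.edges) :
    G.Adj e.1 e.2 := by
  induction p with
  | nil u => simp [edges] at he
  | cons h p ih =>
    rcases List.mem_cons.1 he with rfl | he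
    · exact h
    · exact ih he

theorem fst_mem_support_of_mem_edges {u v : V} (p : G.Walk u v) {e : V × V} (he : e ∈ p.edges) :
    e.1 ∈ p.support := by
  induction p with
  | nil u => simp [edges] at he
  | cons h p ih =>
    rcases List.mem_cons.1 he with rfl | he
    · simp [support]
    · simp [support, ih he]

theorem exists_suffix {u v w : V} (p : G.Walk u v) (h : w ∈ p.support) :
    ∃ q : G.Walk w v, q.support <:+ p.support := by
  induction p with
  | nil u =>
    obtain rfl : w = u := by simpa [support] using h
    exact ⟨.nil _, List.suffix_refl _⟩
  | @cons a b c hab p ih =>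
    by_cases hw : w = a
    · subst hw
      exact ⟨.cons hab p, List.suffix_refl _⟩
    · obtain ⟨q, hq⟩ := ih (by simpa [support, hw] using h)
      exact ⟨q, hq.trans (List.suffix_cons _ _)⟩

/-- Every walk can be shortened to a path. -/
theorem exists_nodup {u v : V} (p : G.Walk u v) : ∃ q : G.Walk u v, q.support.Nodup := by
  induction p with
  | nil u => exact ⟨.nil u, by simp [support]⟩
  | @cons a b c hab p ih =>
    obtain ⟨q, hq⟩ := ih
    by_cases ha : a ∈ q.support
    · obtain ⟨q', hq'⟩ := q.exists_suffix ha
      exact ⟨q', hq.sublist hq'.sublist⟩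
    · exact ⟨.cons hab q, List.nodup_cons.2 ⟨ha, hq⟩⟩

end Walk

theorem Reaches.trans {u v w : V} (h1 : G.Reaches u v) (h2 : G.Reaches v w) : G.Reaches u w := by
  obtain ⟨p⟩ := h1
  obtain ⟨q⟩ := h2
  exact ⟨p.append q⟩

theorem Reaches.mono_of {W : Type*} {H : Digraph W} (f : V → W)
    (hf : ∀ a b, G.Adj a b → H.Reaches (f a) (f b)) {u v : V} (h : G.Reaches u v) :
    H.Reaches (f u) (f v) := by
  obtain ⟨p⟩ := h
  induction p with
  | nil u => exact .refl _
  | cons hab p ih => exact (hf _ _ hab).trans ih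

/-- A set that contains `u` and is closed under out-neighbours contains all vertices reachable
from `u`. -/
theorem Reaches.mem_of_closed {u v : V} (h : G.Reaches u v) {S : Set V} (hu : u ∈ S)
    (hS : ∀ a b, a ∈ S → G.Adj a b → b ∈ S) : v ∈ S := by
  obtain ⟨p⟩ := h
  induction p with
  | nil u => exact hu
  | cons hab p ih => exact ih (hS _ _ hu hab)

theorem reverse_reaches {u v : V} : G.reverse.Reaches u v ↔ G.Reaches v u := by
  have key : ∀ (G : Digraph V) (u v : V), G.Reaches u v → G.reverse.Reaches v u := by
    rintro G u v ⟨p⟩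
    induction p with
    | nil u => exact .refl u
    | cons hab p ih => exact ih.concat hab
  exact ⟨fun h => key _ _ _ h, fun h => key _ _ _ h⟩

theorem StronglyConnected.reverse (hG : G.StronglyConnected) : G.reverse.StronglyConnected :=
  fun u v => reverse_reaches.2 (hG v u)

/-! ### Deleting an edge -/

/-- The digraph obtained by deleting the edge `(u, v)`. -/
def deleteEdge (G : Digraph V) (u v : V) : Digraph V where
  Adj a b := G.Adj a b ∧ (a, b) ≠ (u, v)

theorem reverse_deleteEdge (u v : V) :
    (G.deleteEdge u v).reverse = G.reverse.deleteEdge v u := by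
  ext a b
  simp only [deleteEdge, reverse, ne_eq, Prod.mk.injEq]
  tauto

theorem deleteEdge_reaches {a b u v : V} :
    (G.deleteEdge u v).Reaches a b ↔ ∃ p : G.Walk a b, (u, v) ∉ p.edges := by
  constructor
  · rintro ⟨p⟩
    induction p with
    | nil a => exact ⟨.nil a, by simp [Walk.edges]⟩
    | cons hab p ih =>
      obtain ⟨q, hq⟩ := ih
      exact ⟨.cons hab.1 q, by simpa [Walk.edges, hq] using Ne.symm hab.2⟩
  · rintro ⟨p, hp⟩
    induction p with
    | nil a => exact .refl a
    | cons hab p ih =>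
      simp only [Walk.edges, List.mem_cons, not_or] at hp
      exact (Reaches.of_adj (G := G.deleteEdge u v) ⟨hab, Ne.symm hp.1⟩).trans (ih hp.2)

theorem exists_walk_support_of_deleteEdge {a b u v : V} (p : (G.deleteEdge u v).Walk a b) :
    ∃ q : G.Walk a b, q.support = p.support := by
  induction p with
  | nil a => exact ⟨.nil a, rfl⟩
  | cons hab p ih =>
    obtain ⟨q, hq⟩ := ih
    exact ⟨.cons hab.1 q, by simp [Walk.support, hq]⟩

/-- After its last use of `(u, v)`, a walk continues from `v` without that edge. -/
theorem Reaches.deleteEdge_or {a b : V} (h : G.Reaches a b) (u v : V) :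
    (G.deleteEdge u v).Reaches a b ∨ (G.deleteEdge u v).Reaches v b := by
  obtain ⟨p⟩ := h
  induction p with
  | nil a => exact .inl (.refl a)
  | @cons a b c hab p ih =>
    refine ih.elim (fun h => ?_) .inr
    by_cases he : (a, b) = (u, v)
    · obtain ⟨rfl, rfl⟩ := Prod.mk.inj he
      exact .inr h
    · exact .inl ((Reaches.of_adj (G := G.deleteEdge u v) ⟨hab, he⟩).trans h)

/-! ### Menger's theorem for two edge-disjoint paths -/

namespace Walk

theorem not_exit {u v : V} (p : G.Walk u v) {S : Set V} (hu : u ∉ S)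
    (hS : ∀ e ∈ p.edges, e.2 ∈ S → e.1 ∈ S) : ∀ e ∈ p.edges, e.1 ∉ S := by
  induction p with
  | nil u => simp [edges]
  | @cons a b c hab p ih =>
    simp only [edges, List.forall_mem_cons] at hS ⊢
    exact ⟨hu, ih (fun hb => hu (hS.1 hb)) hS.2⟩

/-- A walk that never enters `S` leaves it at most once. -/
theorem exit_unique {u v : V} (p : G.Walk u v) {S : Set V}
    (hS : ∀ e ∈ p.edges, e.2 ∈ S → e.1 ∈ S) {e e' : V × V} (he : e ∈ p.edges) (he' : e' ∈ p.edges)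
    (h1 : e.1 ∈ S) (h2 : e.2 ∉ S) (h1' : e'.1 ∈ S) (h2' : e'.2 ∉ S) : e = e' := by
  induction p with
  | nil u => simp [edges] at he
  | @cons a b c hab p ih =>
    simp only [edges, List.forall_mem_cons] at hS
    simp only [edges, List.mem_cons] at he he'
    rcases he with rfl | he
    · rcases he' with rfl | he'
      · rfl
      · exact absurd h1' (p.not_exit h2 hS.2 _ he')
    · rcases he' with rfl | he'
      · exact absurd h1 (p.not_exit h2' hS.2 _ he)
      · exact ih hS.2 he he'

theorem exists_exit {u v : V} (p : G.Walk u v) {S : Set V} (hu : u ∈ S) (hv : v ∉ S) :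
    ∃ e ∈ p.edges, e.1 ∈ S ∧ e.2 ∉ S := by
  induction p with
  | nil u => exact absurd hu hv
  | @cons a b c hab p ih =>
    by_cases hb : b ∈ S
    · obtain ⟨e, he, h⟩ := ih hb hv
      exact ⟨e, List.mem_cons_of_mem _ he, h⟩
    · exact ⟨(a, b), by simp [edges], hu, hb⟩

open Classical in
/-- The number of times that a walk uses the edge `(a, b)`. -/
noncomputable def flow {u v : V} (p : G.Walk u v) (a b : V) : ℤ := p.edges.count (a, b)

theorem flow_nonneg {u v : V} (p : G.Walk u v) (a b : V) : 0 ≤ p.flow a b := by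
  simp [flow]

theorem one_le_flow {u v : V} (p : G.Walk u v) {a b : V} : 1 ≤ p.flow a b ↔ (a, b) ∈ p.edges := by
  classical
  rw [← List.count_pos_iff, flow]
  omega

theorem flow_le_one {u v : V} (p : G.Walk u v) (hp : p.support.Nodup) (a b : V) :
    p.flow a b ≤ 1 := by
  classical
  -- Each use of an edge contributes an occurrence of its tail to the support.
  have key : ∀ {u v : V} (p : G.Walk u v), p.edges.count (a, b) ≤ p.support.count a := by
    intro u v p
    induction p with
    | nil u => simp [edges]
    | cons h p ih =>
      simp only [edges, support, List.count_cons]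
      gcongr
      split_ifs <;> simp_all
  have := key p
  have := List.nodup_iff_count_le_one.1 hp a
  rw [flow]
  omega

end Walk

/-- The net outflow of `f` at `v`. -/
noncomputable def netOut [Fintype V] (f : V → V → ℤ) (v : V) : ℤ := ∑ b, f v b - ∑ b, f b v

open Classical in
theorem Walk.netOut_flow [Fintype V] {u w : V} (p : G.Walk u w) (v : V) :
    netOut p.flow v = (if v = u then 1 else 0) - (if v = w then 1 else 0) := by
  induction p with
  | nil u => simp [netOut, flow, edges]
  | @cons a b c hab p ih =>
    have h : ∀ i j, (Walk.cons hab p).flow i j =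
        p.flow i j + (if i = a then if j = b then 1 else 0 else 0) := by
      intro i j
      by_cases hi : a = i ∧ b = j
      · obtain ⟨rfl, rfl⟩ := hi
        simp [flow, edges]
      · have hne : (a, b) ≠ (i, j) := fun h => hi (Prod.mk.inj h)
        have : ¬ (i = a ∧ j = b) := fun h => hi ⟨h.1.symm, h.2.symm⟩
        simp only [flow, edges, List.count_cons_of_ne hne, ← ite_and, if_neg this, add_zero]
    have e : netOut (Walk.cons hab p).flow v = netOut p.flow v +
        ((if v = a then 1 else 0) - (if v = b then 1 else 0)) := by
      simp only [netOut, h, Finset.sum_add_distrib]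
      have h1 : ∑ j, (if v = a then if j = b then (1 : ℤ) else 0 else 0) =
          if v = a then 1 else 0 := by split_ifs <;> simp
      have h2 : ∑ j, (if j = a then if v = b then (1 : ℤ) else 0 else 0) =
          if v = b then 1 else 0 := by simp
      rw [h1, h2]
      ring
    rw [e, ih]
    ring

/-- A flow with positive value contains a walk from its source to its sink. -/
theorem reaches_of_netOut [Fintype V] {x y : V} (f : V → V → ℤ) (hf : ∀ a b, 0 ≤ f a b)
    (hx : 0 < netOut f x) (hv : ∀ v, v ≠ y → 0 ≤ netOut f v) :
    (Digraph.mk fun a b => 0 < f a b).Reaches x y := by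
  classical
  set H : Digraph V := Digraph.mk fun a b => 0 < f a b
  by_contra hxy
  set S : Finset V := {v | H.Reaches x v}
  have hout : ∀ a ∈ S, ∀ b ∉ S, f a b = 0 := by
    intro a ha b hb
    simp only [S, Finset.mem_filter, Finset.mem_univ, true_and] at ha hb
    by_contra h
    exact hb (ha.concat (lt_of_le_of_ne (hf a b) (Ne.symm h)))
  -- The total net outflow of `S` is positive, yet no flow leaves `S` and the flow inside `S`
  -- cancels.
  have h1 : 0 < ∑ v ∈ S, netOut f v := by
    refine Finset.sum_pos' (fun v hvS => hv v ?_) ⟨x, by simpa [S] using Reaches.refl x, hx⟩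
    rintro rfl
    exact hxy (by simpa [S] using hvS)
  have h2 : ∑ v ∈ S, ∑ b, f v b = ∑ v ∈ S, ∑ b ∈ S, f v b :=
    Finset.sum_congr rfl fun a ha => (Finset.sum_subset (Finset.subset_univ S)
      fun b _ hb => hout a ha b hb).symm
  have h3 : ∑ v ∈ S, ∑ b ∈ S, f b v ≤ ∑ v ∈ S, ∑ b, f b v :=
    Finset.sum_le_sum fun v _ => Finset.sum_le_sum_of_subset_of_nonneg (Finset.subset_univ S)
      fun b _ _ => hf b v
  simp only [netOut, Finset.sum_sub_distrib] at h1
  rw [h2, Finset.sum_comm] at h1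
  linarith

open Classical in
-- Removing one path from a 0/1 flow of value two leaves a flow of value one, whose support contains
-- a second path. Unit capacities make the two disjoint.
theorem twoEdgeDisjointPaths_of_flow [Fintype V] {x y : V} (hxy : x ≠ y) (f : V → V → ℤ)
    (h0 : ∀ a b, 0 ≤ f a b) (h1 : ∀ a b, f a b ≤ 1) (hG : ∀ a b, 0 < f a b → G.Adj a b)
    (hf : ∀ v, netOut f v = 2 * ((if v = x then 1 else 0) - (if v = y then 1 else 0))) :
    G.TwoEdgeDisjointPaths x y := by
  have lift : ∀ (g : V → V → ℤ), (∀ a b, 0 < g a b → G.Adj a b) →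
      (Digraph.mk fun a b => 0 < g a b).Reaches x y →
      ∃ p : G.Walk x y, p.support.Nodup ∧ ∀ e ∈ p.edges, 0 < g e.1 e.2 := by
    rintro g hg ⟨p⟩
    obtain ⟨q, hq⟩ := p.exists_nodup
    have : ∀ {u v : V} (q : (Digraph.mk fun a b => 0 < g a b).Walk u v),
        ∃ p : G.Walk u v, p.support = q.support ∧ p.edges = q.edges := by
      intro u v q
      induction q with
      | nil u => exact ⟨.nil u, rfl, rfl⟩
      | cons hab q ih =>
        obtain ⟨p, h1, h2⟩ := ih
        exact ⟨.cons (hg _ _ hab) p, by simp [Walk.support, h1], by simp [Walk.edges, h2]⟩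
    obtain ⟨p, h1, h2⟩ := this q
    exact ⟨p, h1 ▸ hq, fun e he => q.adj_of_mem_edges (h2 ▸ he)⟩
  obtain ⟨p, hp, hpf⟩ := lift f hG <| reaches_of_netOut f h0 (by simp [hf, hxy]) <| by
    intro v hv
    simp only [hf, hv, if_false]
    split_ifs <;> simp
  have hpf' : ∀ a b, p.flow a b ≤ f a b := by
    intro a b
    rcases lt_or_ge (p.flow a b) 1 with h | h
    · have := h0 a b
      omega
    · have := hpf _ (p.one_le_flow.1 h)
      have := p.flow_le_one hp a b
      simp only at *
      omega
  have hnet : ∀ v, netOut (fun a b => f a b - p.flow a b) v =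
      (if v = x then 1 else 0) - (if v = y then 1 else 0) := by
    intro v
    have h1 := hf v
    have h2 := p.netOut_flow v
    simp only [netOut, Finset.sum_sub_distrib] at *
    linarith
  obtain ⟨q, -, hqf⟩ := lift (fun a b => f a b - p.flow a b)
    (fun a b h => hG a b (by have := p.flow_nonneg a b; omega)) <|
    reaches_of_netOut _ (fun a b => by have := hpf' a b; omega) (by simp [hnet, hxy]) <| by
      intro v hv
      simp only [hnet, hv, if_false]
      split_ifs <;> simp
  refine ⟨p, q, fun e he he' => ?_⟩
  have := hqf e he'
  have := p.one_le_flow.2 he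
  have := h1 e.1 e.2
  omega

/-- One augmentation step of Ford and Fulkerson. Given a path `p`, either the residual digraph `R`
has a walk from `x` to `y`, which augments `p` to a flow of value two, or the set reachable in `R`
is left only by edges of `p`. In the latter case `p` never re-enters the set, so it has a single
exit, whose deletion separates `x` from `y`. -/
theorem twoEdgeDisjointPaths_of_forall_deleteEdge [Finite V] {x y : V}
    (h : ∀ u v, (G.deleteEdge u v).Reaches x y) : G.TwoEdgeDisjointPaths x y := by
  classical
  cases nonempty_fintype V
  rcases eq_or_ne x y with rfl | hxy
  · exact ⟨.nil x, .nil x, by simp [Walk.edges]⟩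
  obtain ⟨p⟩ : G.Reaches x y := (deleteEdge_reaches.1 (h x x)).elim fun p _ => ⟨p⟩
  obtain ⟨p, hp⟩ := p.exists_nodup
  let F : V → V → Prop := fun a b => G.Adj a b ∧ (a, b) ∉ p.edges
  let R : Digraph V := Digraph.mk fun a b => F a b ∨ (b, a) ∈ p.edges
  by_cases hR : R.Reaches x y
  · obtain ⟨q⟩ := hR
    obtain ⟨q, hq⟩ := q.exists_nodup
    -- The residual path splits into forward steps `g1` and backward steps `g2`. An edge that
    -- qualifies as both counts as forward.
    let g1 : V → V → ℤ := fun a b => if F a b then q.flow a b else 0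
    let g2 : V → V → ℤ := fun a b => if F a b then 0 else q.flow a b
    have hg2 : ∀ a b, g2 b a = 0 ∨ (g2 b a = 1 ∧ p.flow a b = 1) := by
      intro a b
      simp only [g2]
      split_ifs with hF
      · exact .inl rfl
      · rcases lt_or_ge (q.flow b a) 1 with h | h
        · exact .inl (by have := q.flow_nonneg b a; omega)
        · have h1 := q.flow_le_one hq b a
          have h2 := (q.adj_of_mem_edges (q.one_le_flow.1 h)).resolve_left hF
          have h3 := p.one_le_flow.2 h2
          have h4 := p.flow_le_one hp a b
          simp only at h3
          exact .inr ⟨by omega, by omega⟩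
    have hg1 : ∀ a b, g1 a b = 0 ∨ (g1 a b = 1 ∧ p.flow a b = 0 ∧ G.Adj a b) := by
      intro a b
      simp only [g1]
      split_ifs with hF
      · have h1 := q.flow_le_one hq a b
        have h2 := q.flow_nonneg a b
        have h3 := p.flow_nonneg a b
        have h4 := mt p.one_le_flow.1 hF.2
        rcases eq_or_ne (q.flow a b) 0 with h | h
        · exact .inl h
        · exact .inr ⟨by omega, by omega, hF.1⟩
      · exact .inl rfl
    refine twoEdgeDisjointPaths_of_flow hxy (fun a b => p.flow a b + g1 a b - g2 b a) ?_ ?_ ?_ ?_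
    · intro a b
      have := p.flow_nonneg a b
      rcases hg1 a b with h | h <;> rcases hg2 a b with h' | h' <;> omega
    · intro a b
      have := p.flow_le_one hp a b
      rcases hg1 a b with h | h <;> rcases hg2 a b with h' | h' <;> omega
    · intro a b hab
      rcases hg1 a b with h | h
      · have : 1 ≤ p.flow a b := by rcases hg2 a b with h' | h' <;> omega
        exact p.adj_of_mem_edges (p.one_le_flow.1 this)
      · exact h.2.2
    · intro v
      have h1 := p.netOut_flow v
      have h2 := q.netOut_flow v
      have h3 : ∀ a b, q.flow a b = g1 a b + g2 a b := by
        intro a b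
        simp only [g1, g2]
        split_ifs <;> simp
      simp only [netOut, h3, Finset.sum_sub_distrib, Finset.sum_add_distrib] at *
      linarith
  · exfalso
    have hS : ∀ e ∈ p.edges, e.2 ∈ {v | R.Reaches x v} → e.1 ∈ {v | R.Reaches x v} :=
      fun e he h => Reaches.concat h (Or.inr he)
    obtain ⟨e, he, he1, he2⟩ := p.exists_exit (S := {v | R.Reaches x v}) (Reaches.refl x) hR
    refine hR ((h e.1 e.2).mem_of_closed (S := {v | R.Reaches x v}) (Reaches.refl x) ?_)
    intro a b ha hab
    by_contra hb
    have hmem : (a, b) ∈ p.edges := by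
      by_contra hn
      exact hb (Reaches.concat ha (Or.inl ⟨hab.1, hn⟩))
    exact hab.2 (p.exit_unique hS hmem he ha hb he1 he2)

/-- Menger's theorem for two edge-disjoint paths. -/
theorem twoEdgeDisjointPaths_iff [Finite V] {x y : V} :
    G.TwoEdgeDisjointPaths x y ↔ ∀ u v, (G.deleteEdge u v).Reaches x y := by
  refine ⟨?_, twoEdgeDisjointPaths_of_forall_deleteEdge⟩
  rintro ⟨p, q, hpq⟩ u v
  by_cases h : (u, v) ∈ p.edges
  · exact deleteEdge_reaches.2 ⟨q, hpq h⟩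
  · exact deleteEdge_reaches.2 ⟨p, h⟩

/-! ### Dominators -/

theorem Dominates.refl (v : V) : G.Dominates s v v := fun p => p.end_mem_support

theorem dominates_start (v : V) : G.Dominates s s v := fun p => p.start_mem_support

/-- Cut the walk at its last visit to `{a, b}`. -/
theorem Walk.exists_suffix_avoiding {u v a b : V} (hab : a ≠ b) (p : G.Walk u v)
    (h : a ∈ p.support ∨ b ∈ p.support) :
    (∃ q : G.Walk a v, b ∉ q.support) ∨ ∃ q : G.Walk b v, a ∉ q.support := by
  induction p with
  | nil u =>
    simp only [support, List.mem_singleton] at h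
    rcases h with rfl | rfl
    · exact .inl ⟨.nil _, by simpa [support] using hab.symm⟩
    · exact .inr ⟨.nil _, by simpa [support] using hab⟩
  | @cons c d e hcd p ih =>
    by_cases hp : a ∈ p.support ∨ b ∈ p.support
    · exact ih hp
    · push Not at hp
      simp only [support, List.mem_cons, hp.1, hp.2, or_false] at h
      rcases h with rfl | rfl
      · exact .inl ⟨.cons hcd p, by simpa [support, hp.2] using hab.symm⟩
      · exact .inr ⟨.cons hcd p, by simpa [support, hp.1] using hab⟩

/-- The dominators of a vertex form a chain. -/
theorem Dominates.total {a b v : V} (hv : G.Reaches s v) (ha : G.Dominates s a v)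
    (hb : G.Dominates s b v) : G.Dominates s a b ∨ G.Dominates s b a := by
  by_contra! h
  simp only [Dominates, not_forall] at h
  obtain ⟨⟨p, hp⟩, ⟨q, hq⟩⟩ := h
  obtain ⟨w⟩ := hv
  have hab : a ≠ b := by
    rintro rfl
    exact hp p.end_mem_support
  -- A walk to one of `a`, `b` missing the other, continued by such a suffix, contradicts domination
  -- of `v`.
  rcases w.exists_suffix_avoiding hab (.inl (ha w)) with ⟨w', hw'⟩ | ⟨w', hw'⟩
  · exact ((q.mem_support_append w').1 (hb _)).elim hq hw'
  · exact ((p.mem_support_append w').1 (ha _)).elim hp hw'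

/-- Every vertex other than the start vertex has a parent in the dominator tree. -/
theorem exists_domTree_adj [Finite V] (hs : ∀ v, G.Reaches s v) {v : V} (hv : v ≠ s) :
    ∃ a, (G.domTree s).Adj a v := by
  -- The order is reversed, so a minimal element is the proper dominator of `v` deepest in the tree.
  let R : V → V → Prop := fun a b => a ≠ b ∧ G.Dominates s b a
  have : IsTrans V R := ⟨fun a b c hab hbc => ⟨by
    rintro rfl
    exact hab.1 (hbc.2.antisymm (hs _) hab.2), hbc.2.trans hab.2⟩⟩
  have : Std.Irrefl R := ⟨fun a h => h.1 rfl⟩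
  have wf : WellFounded R := Finite.wellFounded_of_trans_of_irrefl R
  obtain ⟨m, ⟨hm1, hm2⟩, hm⟩ := wf.has_min {w | w ≠ v ∧ G.Dominates s w v}
    ⟨s, hv.symm, dominates_start v⟩
  refine ⟨m, hm1, hm2, fun w hw1 hw2 => ?_⟩
  rcases hw2.total (hs v) hm2 with h | h
  · exact h
  · by_cases hwm : w = m
    · exact hwm ▸ .refl _
    · exact absurd ⟨hwm, h⟩ (hm w ⟨hw1, hw2⟩)

theorem domTree_adj_unique (hs : ∀ v, G.Reaches s v) {a b c : V} (h1 : (G.domTree s).Adj a c)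
    (h2 : (G.domTree s).Adj b c) : a = b :=
  (h2.2.2 a h1.1 h1.2.1).antisymm (hs _) (h1.2.2 b h2.1 h2.2.1)

/-- Induction along the dominator tree. -/
theorem domTree_induction [Finite V] (hs : ∀ v, G.Reaches s v) {P : V → Prop} (v : V)
    (start : P s) (step : ∀ a b, (G.domTree s).Adj a b → P a → P b) : P v := by
  let R : V → V → Prop := fun a b => a ≠ b ∧ G.Dominates s a b
  have : IsTrans V R := ⟨fun a b c hab hbc => ⟨by
    rintro rfl
    exact hab.1 (hab.2.antisymm (hs _) hbc.2), hab.2.trans hbc.2⟩⟩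
  have : Std.Irrefl R := ⟨fun a h => h.1 rfl⟩
  have wf : WellFounded R := Finite.wellFounded_of_trans_of_irrefl R
  induction v using wf.induction with
  | _ v ih =>
    rcases eq_or_ne v s with rfl | hv
    · exact start
    · obtain ⟨a, ha⟩ := exists_domTree_adj hs hv
      exact step a v ha (ih a ⟨ha.1, ha.2.1⟩)

/-! ### Bridges -/

theorem deleteEdge_reaches_of_not_dominates {u v z : V} (h : ¬ G.Dominates s v z) :
    (G.deleteEdge u v).Reaches s z := by
  simp only [Dominates, not_forall] at h
  obtain ⟨p, hp⟩ := h
  induction p with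
  | nil a => exact .refl a
  | @cons a b c hab p ih =>
    simp only [Walk.support, List.mem_cons, not_or] at hp
    refine (Reaches.of_adj (G := G.deleteEdge u v) ⟨hab, fun h => ?_⟩).trans (ih hp.2)
    obtain ⟨rfl, rfl⟩ := Prod.mk.inj h
    exact hp.2 p.start_mem_support

/-- If `v` stayed reachable, so would everything, since walks can be resumed from `v` after their
last use of the edge. -/
theorem isBridge_of_not_reaches (hs : ∀ v, G.Reaches s v) {u v z : V}
    (h : ¬ (G.deleteEdge u v).Reaches s z) : G.IsBridge s u v := by
  have hv : ¬ (G.deleteEdge u v).Reaches s v := fun hv =>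
    h (((hs z).deleteEdge_or u v).elim id hv.trans)
  have he : ∀ p : G.Walk s v, (u, v) ∈ p.edges := by
    intro p
    by_contra hp
    exact hv (deleteEdge_reaches.2 ⟨p, hp⟩)
  obtain ⟨p⟩ := hs v
  exact ⟨p.adj_of_mem_edges (he p), he⟩

/-- The descendants of the head of a bridge are the vertices cut off by deleting the bridge. -/
theorem IsBridge.dominates_iff {u v z : V} (h : G.IsBridge s u v) :
    G.Dominates s v z ↔ ¬ (G.deleteEdge u v).Reaches s z := by
  refine ⟨?_, fun hz => by_contra fun hd => hz (deleteEdge_reaches_of_not_dominates hd)⟩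
  rintro hd ⟨p⟩
  obtain ⟨q, hq⟩ := exists_walk_support_of_deleteEdge p
  obtain ⟨p', -⟩ := p.exists_prefix (hq ▸ hd q)
  obtain ⟨q', hq'⟩ := deleteEdge_reaches.1 ⟨p'⟩
  exact hq' (h.2 q')

theorem IsBridge.ne (hs : ∀ v, G.Reaches s v) {u v : V} (h : G.IsBridge s u v) : u ≠ v := by
  rintro rfl
  refine h.dominates_iff.1 (.refl u) ?_
  obtain ⟨p⟩ := hs u
  clear h hs
  induction p with
  | nil a => exact .refl a
  | @cons a b c hab p ih =>
    by_cases he : (a, b) = (c, c)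
    · rw [(Prod.mk.inj he).1]
      exact .refl c
    · exact (Reaches.of_adj (G := G.deleteEdge c c) ⟨hab, he⟩).trans ih

theorem IsBridge.domTree_adj (hs : ∀ v, G.Reaches s v) {u v : V} (h : G.IsBridge s u v) :
    (G.domTree s).Adj u v := by
  refine ⟨h.ne hs, fun p => p.fst_mem_support_of_mem_edges (h.2 p), fun w hw hd p => ?_⟩
  rcases (p.mem_support_append (.cons h.1 (.nil v))).1 (hd _) with h' | h'
  · exact h'
  · simp only [Walk.support, List.mem_cons, hw, List.not_mem_nil, or_false] at h'
    exact h' ▸ p.end_mem_support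

theorem domTree_adj_not_dominates (hs : ∀ v, G.Reaches s v) {u v : V}
    (h : (G.domTree s).Adj u v) : ¬ G.Dominates s v u :=
  fun hd => h.1 (h.2.1.antisymm (hs _) hd)

/-- The subtree of the head of a bridge can only be entered by the bridge. -/
theorem IsBridge.eq_of_enter {u v p q : V} (h : G.IsBridge s u v)
    (hpq : G.Adj p q) (hp : ¬ G.Dominates s v p) (hq : G.Dominates s v q) : p = u ∧ q = v := by
  by_contra hne
  rw [h.dominates_iff, not_not] at hp
  exact h.dominates_iff.1 hq (Reaches.concat hp ⟨hpq, fun e => hne (Prod.mk.inj e)⟩)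

/-- In the subtree of the head of a bridge, descendants can be reached without the bridge. -/
theorem IsBridge.reaches_descendant (hs : ∀ v, G.Reaches s v) {u v a p : V}
    (h : G.IsBridge s u v) (ha : G.Dominates s v a) (hp : G.Dominates s a p) :
    (G.deleteEdge u v).Reaches a p := by
  obtain ⟨w⟩ := ((hs p).deleteEdge_or u v).resolve_left (h.dominates_iff.1 (ha.trans hp))
  -- Continue `q` by the bridge and the walk `w` from `v` to `p`. The dominator `a` must lie on the
  -- result but not on `q`, hence on `w`, whose suffix from `a` is the desired walk.
  obtain ⟨q, hq⟩ : ∃ q : G.Walk s u, a ∉ q.support := by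
    by_contra! hd
    exact domTree_adj_not_dominates hs (h.domTree_adj hs) (ha.trans hd)
  obtain ⟨w', hw'⟩ := exists_walk_support_of_deleteEdge w
  have hmem := hp (q.append (.cons h.1 w'))
  simp only [Walk.mem_support_append, Walk.support, List.mem_cons] at hmem
  have haw : a ∈ w.support := by
    rcases hmem with h' | rfl | h'
    · exact absurd h' hq
    · exact absurd q.end_mem_support hq
    · exact hw' ▸ h'
  obtain ⟨w'', -⟩ := w.exists_suffix haw
  exact ⟨w''⟩

/-! ### Roots of the bridge decomposition -/

theorem isBridgeRoot_bridgeRoot [Finite V] (hs : ∀ v, G.Reaches s v) (x : V) :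
    G.IsBridgeRoot s (G.bridgeRoot s x) x := by
  have h := (existsUnique_isBridgeRoot G s hs x).exists
  rw [bridgeRoot, dif_pos h]
  exact h.choose_spec

theorem bridgeRoot_eq_iff [Finite V] (hs : ∀ v, G.Reaches s v) {r x : V} :
    G.bridgeRoot s x = r ↔ G.IsBridgeRoot s r x :=
  ⟨fun h => h ▸ isBridgeRoot_bridgeRoot hs x, fun h =>
    (existsUnique_isBridgeRoot G s hs x).unique (isBridgeRoot_bridgeRoot hs x) h⟩

theorem dominates_of_reaches_bridgeForest {a b : V} (h : (G.bridgeForest s).Reaches a b) :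
    G.Dominates s a b := by
  obtain ⟨p⟩ := h
  induction p with
  | nil a => exact .refl a
  | cons hab p ih => exact hab.1.2.1.trans ih

theorem bridgeRoot_dominates [Finite V] (hs : ∀ v, G.Reaches s v) (x : V) :
    G.Dominates s (G.bridgeRoot s x) x :=
  dominates_of_reaches_bridgeForest (isBridgeRoot_bridgeRoot hs x).1

/-- The root of a vertex is the start vertex or the head of a bridge. -/
theorem bridgeRoot_eq_start_or [Finite V] (hs : ∀ v, G.Reaches s v) (x : V) :
    G.bridgeRoot s x = s ∨ ∃ u, G.IsBridge s u (G.bridgeRoot s x) := by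
  refine or_iff_not_imp_left.2 fun h => ?_
  obtain ⟨a, ha⟩ := exists_domTree_adj hs h
  exact ⟨a, by_contra fun hb => (isBridgeRoot_bridgeRoot hs x).2 a ⟨ha, hb⟩⟩

/-- Climbing from `x` to its root, the subtree of `v` could be left only through the tree edge `(u,
v)`, which the forest lacks. -/
theorem IsBridge.dominates_bridgeRoot [Finite V] (hs : ∀ v, G.Reaches s v) {u v x : V}
    (h : G.IsBridge s u v) (hx : G.Dominates s v x) : G.Dominates s v (G.bridgeRoot s x) := by
  obtain ⟨p⟩ := (isBridgeRoot_bridgeRoot hs x).1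
  revert hx p
  generalize G.bridgeRoot s x = r
  intro hx p
  induction p with
  | nil a => exact hx
  | @cons a b c hab p ih =>
    refine hab.1.2.2 v ?_ (ih hx)
    rintro rfl
    obtain rfl := domTree_adj_unique hs hab.1 (h.domTree_adj hs)
    exact hab.2 h

theorem mem_auxVertices_of_adj [Finite V] (hs : ∀ v, G.Reaches s v) {r a w : V}
    (ha : a ∈ G.auxVertices s r) (haw : (G.bridgeForest s).Adj a w) : w ∈ G.auxVertices s r := by
  have h := (bridgeRoot_eq_iff hs).1 ha
  exact (bridgeRoot_eq_iff hs).2 ⟨h.1.concat haw, h.2⟩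

/-! ### The contraction -/

theorem isBridge_of_leave [Finite V] (hs : ∀ v, G.Reaches s v) {r a w : V}
    (ha : a ∈ G.auxVertices s r) (haw : (G.domTree s).Adj a w) (hw : w ∉ G.auxVertices s r) :
    G.IsBridge s a w :=
  by_contra fun h => hw (mem_auxVertices_of_adj hs ha ⟨haw, h⟩)

/-- Otherwise `w` would dominate the root `r` of `c`, hence also its own parent `a`. -/
theorem not_dominates_of_leave [Finite V] (hs : ∀ v, G.Reaches s v) {r a w c : V}
    (ha : a ∈ G.auxVertices s r) (haw : (G.domTree s).Adj a w) (hw : w ∉ G.auxVertices s r)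
    (hc : c ∈ G.auxVertices s r) : ¬ G.Dominates s w c := by
  intro hd
  have h1 := (isBridge_of_leave hs ha haw hw).dominates_bridgeRoot hs hd
  have h2 := bridgeRoot_dominates hs a
  rw [show G.bridgeRoot s c = r from hc] at h1
  rw [show G.bridgeRoot s a = r from ha] at h2
  exact domTree_adj_not_dominates hs haw (h1.trans h2)

theorem ContractsTo.dominates {r v a : V} (h : G.ContractsTo s r v a) : G.Dominates s a v := by
  rcases h.2 with rfl | ⟨w, hw, -, hd⟩
  · exact .refl _
  · exact hw.2.1.trans hd

theorem ContractsTo.unique [Finite V] (hs : ∀ v, G.Reaches s v) {r v a b : V}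
    (ha : G.ContractsTo s r v a) (hb : G.ContractsTo s r v b) : a = b := by
  obtain ⟨ha, rfl | ⟨w, hw, hwr, hd⟩⟩ := ha
  · obtain ⟨hb, rfl | ⟨w', hw', hwr', hd'⟩⟩ := hb
    · rfl
    · exact absurd hd' (not_dominates_of_leave hs hb hw' hwr' ha)
  · obtain ⟨hb, rfl | ⟨w', hw', hwr', hd'⟩⟩ := hb
    · exact absurd hd (not_dominates_of_leave hs ha hw hwr hb)
    -- Two distinct heads above `v` are comparable, so one dominates the parent of the other, a
    -- vertex of `V_r`.
    · rcases eq_or_ne w w' with rfl | hne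
      · exact domTree_adj_unique hs hw hw'
      · rcases hd.total (hs v) hd' with h | h
        · exact absurd (hw'.2.2 w hne h) (not_dominates_of_leave hs ha hw hwr hb)
        · exact absurd (hw.2.2 w' hne.symm h) (not_dominates_of_leave hs hb hw' hwr' ha)

theorem ContractsTo.refl {r a : V} (ha : a ∈ G.auxVertices s r) : G.ContractsTo s r a a :=
  ⟨ha, .inl rfl⟩

theorem bridgeRoot_bridgeRoot [Finite V] (hs : ∀ v, G.Reaches s v) (x : V) :
    G.bridgeRoot s x ∈ G.auxVertices s (G.bridgeRoot s x) :=
  (bridgeRoot_eq_iff hs).2 ⟨.refl _, (isBridgeRoot_bridgeRoot hs x).2⟩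

theorem exists_contractsTo [Finite V] (hs : ∀ v, G.Reaches s v) {r v : V}
    (hr : r ∈ G.auxVertices s r) (hv : G.Dominates s r v) : ∃ a, G.ContractsTo s r v a := by
  induction v using domTree_induction hs with
  | start =>
    obtain rfl := hv.antisymm (hs _) (dominates_start r)
    exact ⟨_, .refl hr⟩
  | step b v hb ih =>
    rcases eq_or_ne r v with rfl | hne
    · exact ⟨_, .refl hr⟩
    obtain ⟨a, ha, rfl | ⟨w, hw, hwr, hd⟩⟩ := ih (hb.2.2 r hne hv)
    · by_cases hvr : v ∈ G.auxVertices s r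
      · exact ⟨v, .refl hvr⟩
      · exact ⟨b, ha, .inr ⟨v, hb, hvr, .refl v⟩⟩
    · exact ⟨a, ha, .inr ⟨w, hw, hwr, hd.trans hb.2.1⟩⟩

/-- An edge of an auxiliary graph joining different vertices comes from an edge of the digraph
whose head is not contracted. -/
theorem exists_adj_of_auxGraph_adj [Finite V] (hs : ∀ v, G.Reaches s v) {r : V}
    {a b : G.auxVertices s r} (h : (G.auxGraph s r).Adj a b) (hab : a ≠ b) :
    ∃ p, G.Adj p b ∧ G.Dominates s a p := by
  obtain ⟨p, q, hpq, hp, hq⟩ := h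
  obtain ⟨hb, rfl | ⟨w, hw, hwr, hd⟩⟩ := hq
  · exact ⟨p, hpq, hp.dominates⟩
  · refine absurd (Subtype.ext (hp.unique hs ?_)) hab
    -- The edge lies inside the subtree contracted into `b`, or enters it and is then the bridge
    -- `(b, w)`. Both ways its tail contracts to `b` as well.
    by_cases hwp : G.Dominates s w p
    · exact ⟨hb, .inr ⟨w, hw, hwr, hwp⟩⟩
    · rw [((isBridge_of_leave hs hb hw hwr).eq_of_enter hpq hwp hd).1]
      exact .refl hb

theorem auxComponent_eq {r x : V} (hx : x ∈ G.auxVertices s r) :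
    G.auxComponent s x = Subtype.val '' (G.auxGraph s r).scc ⟨x, hx⟩ := by
  have h : G.bridgeRoot s x = r := hx
  subst h
  rfl

theorem auxComponent_eq_of_reaches {r x y : V} (hx : x ∈ G.auxVertices s r)
    (hy : y ∈ G.auxVertices s r) (h : (G.auxGraph s r).Reaches ⟨x, hx⟩ ⟨y, hy⟩)
    (h' : (G.auxGraph s r).Reaches ⟨y, hy⟩ ⟨x, hx⟩) : G.auxComponent s x = G.auxComponent s y := by
  rw [auxComponent_eq hx, auxComponent_eq hy]
  congr 1
  ext z
  exact ⟨fun hz => ⟨h'.trans hz.1, hz.2.trans h⟩, fun hz => ⟨h.trans hz.1, hz.2.trans h'⟩⟩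

theorem auxGraph_reaches_of_auxComponent_inter {r x y z : V} (hx : x ∈ G.auxVertices s r)
    (hy : y ∈ G.auxVertices s r) (h : z ∈ G.auxComponent s x) (h' : z ∈ G.auxComponent s y) :
    (G.auxGraph s r).Reaches ⟨x, hx⟩ ⟨y, hy⟩ := by
  rw [auxComponent_eq hx] at h
  rw [auxComponent_eq hy] at h'
  obtain ⟨a, ha, rfl⟩ := h
  obtain ⟨b, hb, hab⟩ := h'
  obtain rfl := Subtype.ext hab
  exact ha.1.trans hb.2

/-! ### Vertices that no single edge deletion separates -/

theorem bridgeRoot_dominates_bridgeRoot [Finite V] (hs : ∀ v, G.Reaches s v) {x y : V}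
    (h : ∀ u v, (G.deleteEdge u v).Reaches y x) :
    G.Dominates s (G.bridgeRoot s x) (G.bridgeRoot s y) := by
  rcases bridgeRoot_eq_start_or hs x with hr | ⟨u, hu⟩
  · rw [hr]
    exact dominates_start _
  · refine hu.dominates_bridgeRoot hs (hu.dominates_iff.2 fun hy => ?_)
    exact hu.dominates_iff.1 (bridgeRoot_dominates hs x) (hy.trans (h _ _))

theorem auxGraph_reaches_of_deleteEdge [Finite V] (hs : ∀ v, G.Reaches s v) {r x y : V}
    (hx : x ∈ G.auxVertices s r) (hy : y ∈ G.auxVertices s r)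
    (h : ∀ u v, (G.deleteEdge u v).Reaches x y) :
    (G.auxGraph s r).Reaches ⟨x, hx⟩ ⟨y, hy⟩ := by
  have hyr : G.bridgeRoot s y = r := hy
  have hr : r ∈ G.auxVertices s r := hyr ▸ bridgeRoot_bridgeRoot hs y
  have hry : G.Dominates s r y := hyr ▸ bridgeRoot_dominates hs y
  obtain ⟨u, hu⟩ : ∃ u, ∀ p q, G.Dominates s r q → (G.deleteEdge u r).Adj p q →
      G.Dominates s r p := by
    rcases hyr ▸ bridgeRoot_eq_start_or hs y with rfl | ⟨u, hu⟩
    -- At the start vertex there is no subtree to enter, so any edge may be deleted.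
    · exact ⟨r, fun p _ _ _ => dominates_start p⟩
    · refine ⟨u, fun p q hq hpq => by_contra fun hp => hpq.2 ?_⟩
      obtain ⟨rfl, rfl⟩ := hu.eq_of_enter hpq.1 hp hq
      rfl
  obtain ⟨p⟩ := h u r
  have key : ∀ {a b : V} (p : (G.deleteEdge u r).Walk a b) (hb : b ∈ G.auxVertices s r),
      G.Dominates s r b → G.Dominates s r a ∧
        ∀ c, ∀ hc : G.ContractsTo s r a c, (G.auxGraph s r).Reaches ⟨c, hc.1⟩ ⟨b, hb⟩ := by
    intro a b p hb hrb
    induction p with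
    | nil a =>
      refine ⟨hrb, fun c hc => ?_⟩
      obtain rfl := hc.unique hs (.refl hb)
      exact .refl _
    | @cons a d b had p ih =>
      obtain ⟨h1, h2⟩ := ih hb hrb
      obtain ⟨e, he⟩ := exists_contractsTo hs hr h1
      refine ⟨hu _ _ h1 had, fun c hc => Reaches.trans (.of_adj ?_) (h2 e he)⟩
      exact ⟨a, d, had.1, hc, he⟩
  exact (key p hy hry).2 x (.refl hx)

/-- Vertices that no single edge deletion separates have the same root and lie in the same
auxiliary component. -/
theorem auxComponent_eq_of_deleteEdge [Finite V] (hs : ∀ v, G.Reaches s v) {x y : V}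
    (h : ∀ u v, (G.deleteEdge u v).Reaches x y) (h' : ∀ u v, (G.deleteEdge u v).Reaches y x) :
    G.bridgeRoot s x = G.bridgeRoot s y ∧ G.auxComponent s x = G.auxComponent s y := by
  have hr : G.bridgeRoot s x = G.bridgeRoot s y :=
    (bridgeRoot_dominates_bridgeRoot hs h').antisymm (hs _) (bridgeRoot_dominates_bridgeRoot hs h)
  have hx : x ∈ G.auxVertices s (G.bridgeRoot s y) := hr
  exact ⟨hr, auxComponent_eq_of_reaches hx rfl (auxGraph_reaches_of_deleteEdge hs hx rfl h)
    (auxGraph_reaches_of_deleteEdge hs rfl hx h')⟩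

/-! ### Vertices in the same auxiliary component -/

/-- A walk in an auxiliary graph lifts to a walk that avoids a given bridge above it. -/
theorem deleteEdge_reaches_of_auxGraph [Finite V] (hs : ∀ v, G.Reaches s v) {u v r : V}
    {a b : G.auxVertices s r} (ha : ¬ (G.deleteEdge u v).Reaches s a)
    (h : (G.auxGraph s r).Reaches a b) : (G.deleteEdge u v).Reaches a b := by
  have hb := isBridge_of_not_reaches hs ha
  have hvr : G.Dominates s v r := by
    have := hb.dominates_bridgeRoot hs (hb.dominates_iff.2 ha)
    rwa [show G.bridgeRoot s a = r from a.2] at this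
  refine h.mono_of Subtype.val fun c d hcd => ?_
  rcases eq_or_ne c d with rfl | hne
  · exact .refl _
  obtain ⟨p, hpd, hcp⟩ := exists_adj_of_auxGraph_adj hs hcd hne
  have hrc : G.Dominates s r c := by
    have := bridgeRoot_dominates hs c.1
    rwa [show G.bridgeRoot s c = r from c.2] at this
  -- The contracted part of the edge is replaced by a walk from `c` down to its descendant `p`. The
  -- edge `(p, d)` is not the bridge, since `p` lies below `v` and `u` does not.
  refine (hb.reaches_descendant hs (hvr.trans hrc) hcp).concat ⟨hpd, fun he => ?_⟩
  obtain ⟨rfl, -⟩ := Prod.mk.inj he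
  exact domTree_adj_not_dominates hs (hb.domTree_adj hs) ((hvr.trans hrc).trans hcp)

/-- A canonical vertex determines its auxiliary component within a tree of the bridge
decomposition. -/
theorem deleteEdge_reaches_of_canonical_eq [Finite V] (hs : ∀ v, G.Reaches s v)
    {can : Set V → V} (hcan : G.IsCanonicalChoice s can) {x y u v : V}
    (hr : G.bridgeRoot s x = G.bridgeRoot s y)
    (hc : can (G.auxComponent s x) = can (G.auxComponent s y))
    (hx : ¬ (G.deleteEdge u v).Reaches s x) : (G.deleteEdge u v).Reaches x y :=
  deleteEdge_reaches_of_auxGraph hs (a := ⟨x, hr⟩) (b := ⟨y, rfl⟩) hx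
    (auxGraph_reaches_of_auxComponent_inter hr rfl (hcan x) (hc ▸ hcan y))

/-- Vertices with the same root are cut off from the start vertex by the same edges. -/
theorem not_reaches_of_bridgeRoot_eq [Finite V] (hs : ∀ v, G.Reaches s v) {x y u v : V}
    (hr : G.bridgeRoot s x = G.bridgeRoot s y) (hx : ¬ (G.deleteEdge u v).Reaches s x) :
    ¬ (G.deleteEdge u v).Reaches s y := by
  have hb := isBridge_of_not_reaches hs hx
  have h := hb.dominates_bridgeRoot hs (hb.dominates_iff.2 hx)
  exact hb.dominates_iff.1 ((hr ▸ h).trans (bridgeRoot_dominates hs y))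

theorem deleteEdge_reaches_of_label_eq [Finite V] (hG : G.StronglyConnected)
    {can canR : Set V → V} (hcan : G.IsCanonicalChoice s can)
    (hcanR : G.reverse.IsCanonicalChoice s canR) {x y : V}
    (h : G.label s can canR x = G.label s can canR y) (u v : V) :
    (G.deleteEdge u v).Reaches x y := by
  simp only [label, Prod.mk.injEq] at h
  obtain ⟨hr, hc, hrR, hcR⟩ := h
  by_cases hsx : (G.deleteEdge u v).Reaches s x
  · by_cases hxs : (G.deleteEdge u v).Reaches x s
    · exact hxs.trans (by_contra fun hsy => not_reaches_of_bridgeRoot_eq (hG s) hr.symm hsy hsx)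
    -- In the reverse digraph the desired walk runs from `y` to `x`, and `y` is cut off from `s`
    -- because `x` is.
    · rw [← reverse_reaches, reverse_deleteEdge] at hxs ⊢
      exact deleteEdge_reaches_of_canonical_eq (hG.reverse s) hcanR hrR.symm hcR.symm
        (not_reaches_of_bridgeRoot_eq (hG.reverse s) hrR hxs)
  · exact deleteEdge_reaches_of_canonical_eq (hG s) hcan hr hc hsx

end Digraph

theorem mainTheorem4 {V : Type*} [Finite V] (G : Digraph V) (hG : G.StronglyConnected) (s : V)
    (can canR : Set V → V) (hcan : G.IsCanonicalChoice s can)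
    (hcanR : G.reverse.IsCanonicalChoice s canR) (x y : V) :
    G.TwoEdgeConnected x y ↔ G.label s can canR x = G.label s can canR y := by
  rw [Digraph.TwoEdgeConnected, Digraph.twoEdgeDisjointPaths_iff, Digraph.twoEdgeDisjointPaths_iff]
  constructor
  · rintro ⟨h, h'⟩
    have hrev : ∀ {a b : V}, (∀ u v, (G.deleteEdge u v).Reaches a b) →
        ∀ u v, (G.reverse.deleteEdge u v).Reaches b a := by
      intro a b hab u v
      rw [← Digraph.reverse_deleteEdge, Digraph.reverse_reaches]
      exact hab v u
    obtain ⟨h1, h2⟩ := Digraph.auxComponent_eq_of_deleteEdge (hG s) h h'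
    obtain ⟨h3, h4⟩ := Digraph.auxComponent_eq_of_deleteEdge (hG.reverse s) (hrev h') (hrev h)
    simp only [Digraph.label, h1, h2, h3, h4]
  · exact fun h => ⟨Digraph.deleteEdge_reaches_of_label_eq hG hcan hcanR h,
      Digraph.deleteEdge_reaches_of_label_eq hG hcan hcanR h.symm⟩
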